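/- Consider five tripartite product states $|\psi_j\rangle=|\varphi_{1,j}\rangle\otimes|\varphi_{2,j}\rangle\otimes|\varphi_{3,j}\rangle$, $j=1,\dots,5$, with unit vectors $|\varphi_{i,j}\rangle\in\mathbb{C}^{d_i}$ ($d_1,d_2,d_3$ arbitrary and finite), such that any two of the states are orthogonal on exactly one subsystem, i.e. for $j\neq k$ there is exactly one $i$ with $\langle\varphi_{i,j}|\varphi_{i,k}\rangle=0$. The orthogonality graph of the states has the vertices $1,\dots,5$ and an edge of colour $i$ between $j$ and $k$ whenever $\langle\varphi_{i,j}|\varphi_{i,k}\rangle=0$; the vector of the numbers of pairwise orthogonal relations is $(a,b,c)$ if the graph has $a$, $b$, $c$ edges of colour $1$, $2$, $3$. Graphs that differ only by relabelling the states and interchanging the parties are identified. States are perfectly distinguished by LOCC if some protocol consisting of finitely many rounds of local measurements and classical communication identifies each of them with probability $1$. Theorem. Exactly 27 orthogonality graphs, (13-1), …, (13-27), occur for five such states with vector $(4,3,3)$. If the orthogonality graph is none of the two graphs (13-22) and (13-27) below, then the five states can be perfectly distinguished by LOCC. The two graphs are genuine exceptions: for each of them there are five such states with this orthogonality graph and vector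 $(4,3,3)$ that cannot be perfectly distinguished by LOCC. Here (writing $jk$ for the edge between $j$ and $k$) - (13-22) has the edges $14,25,34,35$ of colour $1$, the edges $15,24,13$ of colour $2$ and the edges $12,45,23$ of colour $3$; - (13-27) has the edges $12,45,34,35$ of colour $1$, the edges $14,25,13$ of colour $2$ and the edges $15,24,23$ of colour $3$. In both of these graphs some four of the five states (namely $1,2,4,5$) have the graph (1-3), i.e. among these four states the edges of each of the three colours form a perfect matching. -/

import Mathlib

namespace LocalDiscrimination

/-- The joint Hilbert space `ℂ^(d 0) ⊗ ⋯ ⊗ ℂ^(d (m-1))`, in coordinates with respect to the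
product basis. -/
abbrev StateSpace {m : ℕ} (d : Fin m → ℕ) : Type := EuclideanSpace ℂ (∀ p, Fin (d p))

/-- The product vector `v 0 ⊗ ⋯ ⊗ v (m-1)`. -/
noncomputable def productState {m : ℕ} {d : Fin m → ℕ}
    (v : ∀ p, EuclideanSpace ℂ (Fin (d p))) : StateSpace d :=
  WithLp.toLp 2 fun x => ∏ p, v p (x p)

/-- The operator `M` on the subsystem `p`, tensored with the identity on all other subsystems,
applied to `ψ`. -/
noncomputable def applyLocal {m : ℕ} {d : Fin m → ℕ} (p : Fin m)
    (M : Matrix (Fin (d p)) (Fin (d p)) ℂ) (ψ : StateSpace d) : StateSpace d :=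
  WithLp.toLp 2 fun x => ∑ j, M (x p) j * ψ (Function.update x p j)

/-- A protocol of local operations and classical communication with finitely many rounds and with
final answer in `α`. Either the protocol stops with an answer, or some party `p` measures its own
subsystem with measurement operators `M 0, …, M (k-1)`, `∑ i, (M i)ᴴ * M i = 1`, announces the
outcome `i`, and all parties go on with the protocol `next i`. -/
inductive Protocol {m : ℕ} (d : Fin m → ℕ) (α : Type) : Type where
  | output (a : α) : Protocol d α
  | measure (p : Fin m) (k : ℕ) (M : Fin k → Matrix (Fin (d p)) (Fin (d p)) ℂ)
      (complete : ∑ i, (M i).conjTranspose * M i = 1) (next : Fin k → Protocol d α) : Protocol d α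

/-- The probability (Born rule) that the protocol, run on the state `ψ`, answers `a`. States after
a measurement are kept unnormalized, so that the squared norm at the end of a branch is the
probability of the branch. -/
noncomputable def Protocol.prob {m : ℕ} {d : Fin m → ℕ} {α : Type} [DecidableEq α] :
    Protocol d α → StateSpace d → α → ℝ
  | .output b, ψ, a => if b = a then ‖ψ‖ ^ 2 else 0
  | .measure p _ M _ next, ψ, a => ∑ i, (next i).prob (applyLocal p (M i) ψ) a

/-- The states `ψ 0, …, ψ (n-1)` can be perfectly distinguished by LOCC: some protocol identifies
each of them with probability one. -/
def PerfectlyDistinguishable {m n : ℕ} {d : Fin m → ℕ} (ψ : Fin n → StateSpace d) : Prop :=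
  ∃ P : Protocol d (Fin n), ∀ j, P.prob (ψ j) j = 1

/-- `v j p` is the `p`-th factor of the `j`-th state. The factors are normalized, and any two of the
product states are orthogonal on exactly one subsystem. -/
structure IsSinglyOrthogonal {m n : ℕ} {d : Fin m → ℕ}
    (v : Fin n → ∀ p, EuclideanSpace ℂ (Fin (d p))) : Prop where
  norm_eq_one : ∀ j p, ‖v j p‖ = 1
  existsUnique_orthogonal : ∀ j k, j ≠ k → ∃! p, inner ℂ (v j p) (v k p) = 0

/-- The orthogonality graph of a family of product states: the vertices are the states, and there
is an edge of colour `p` between two states if they are orthogonal on the subsystem `p`. -/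
def orthogonalityGraph {m n : ℕ} {d : Fin m → ℕ}
    (v : Fin n → ∀ p, EuclideanSpace ℂ (Fin (d p))) (p : Fin m) : SimpleGraph (Fin n) where
  Adj j k := j ≠ k ∧ inner ℂ (v j p) (v k p) = 0
  symm := ⟨fun _ _ h => ⟨h.1.symm, inner_eq_zero_symm.mp h.2⟩⟩
  loopless := ⟨fun _ h => h.1 rfl⟩

/-- The vector of the numbers of pairwise orthogonal relations on the subsystems. -/
noncomputable def orthogonalityVector {m n : ℕ} {d : Fin m → ℕ}
    (v : Fin n → ∀ p, EuclideanSpace ℂ (Fin (d p))) (p : Fin m) : ℕ :=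
  (orthogonalityGraph v p).edgeSet.ncard

/-- Two edge-coloured graphs agree up to relabelling the states and interchanging the parties. -/
def SameGraph {m n : ℕ} (G H : Fin m → SimpleGraph (Fin n)) : Prop :=
  ∃ (σ : Equiv.Perm (Fin n)) (τ : Equiv.Perm (Fin m)),
    ∀ p j k, (H (τ p)).Adj (σ j) (σ k) ↔ (G p).Adj j k

/-- The graph on four states in which each of the three colours is a perfect matching. -/
def graphMatchings : Fin 3 → SimpleGraph (Fin 4) :=
  ![SimpleGraph.fromEdgeSet {s(0, 1), s(2, 3)},
    SimpleGraph.fromEdgeSet {s(0, 2), s(1, 3)},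
    SimpleGraph.fromEdgeSet {s(0, 3), s(1, 2)}]

/-- Among some four of the five states, each of the three colours is a perfect matching. -/
def HasMatchings (G : Fin 3 → SimpleGraph (Fin 5)) : Prop :=
  ∃ f : Fin 4 ↪ Fin 5, SameGraph (fun p => (G p).comap f) graphMatchings

/-- The first exceptional graph: the edges of the first colour form the path 0, 3, 2, 4, 1. -/
def graphPath : Fin 3 → SimpleGraph (Fin 5) :=
  ![SimpleGraph.fromEdgeSet {s(0, 3), s(1, 4), s(2, 3), s(2, 4)},
    SimpleGraph.fromEdgeSet {s(0, 4), s(1, 3), s(0, 2)},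
    SimpleGraph.fromEdgeSet {s(0, 1), s(3, 4), s(1, 2)}]

/-- The second exceptional graph: the edges of the first colour form the triangle 2, 3, 4 and the
edge between 0 and 1. -/
def graphTriangle : Fin 3 → SimpleGraph (Fin 5) :=
  ![SimpleGraph.fromEdgeSet {s(0, 1), s(3, 4), s(2, 3), s(2, 4)},
    SimpleGraph.fromEdgeSet {s(0, 3), s(1, 4), s(0, 2)},
    SimpleGraph.fromEdgeSet {s(0, 4), s(1, 3), s(1, 2)}]

end LocalDiscrimination

namespace LocalDiscrimination

open Matrix
open scoped ComplexOrder

/-! ### Local operators on product vectors -/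

section ProductStates

variable {m : ℕ} {d : Fin m → ℕ}

/-! Local measurements keep product vectors products, so a branch of a protocol is described by one
accumulated operator per party. Without normalization, identification with certainty passes to every
branch, because probabilities are bounded by squared norms that add up (`identifies_measure_iff`).
States so identified are orthogonal in every branch.

Distinguishability: a party measures the projection onto the line of one factor `u`, belonging to a
state `s`, against its complement. The complement removes `s`; the projection removes the states
orthogonal to `s` there and makes the remaining factors of that party parallel. If every pair
orthogonal at this party contains a state orthogonal to `u`, orthogonality survives either way. This
depends on the graph alone, so `reducible` is a finite game, won on 25 of the graphs.

Indistinguishability: for explicit states with either exceptional graph, certain pairs can stay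
orthogonal only at the party where they began. This forces the accumulated `F = Tᴴ * T` of each
party to be scalar on a plane of `ℂ^3`. Some outcome always keeps that scalar positive, so two
states survive to a leaf, where only one answer is given (`not_identifies`).

Classification: colourings are pairs of ten-bit masks. Lowering them lexicographically by
transpositions and by exchanging the two colours of equal size ends in a finite list, checked by
computation; a numerical invariant separates the 27 graphs. Every graph is realizable, as each
colour can be realized separately in its own space. -/

theorem inner_productState (v w : ∀ p, EuclideanSpace ℂ (Fin (d p))) :
    inner ℂ (productState v) (productState w) = ∏ p, inner ℂ (v p) (w p) := by
  simp only [productState, PiLp.inner_apply, RCLike.inner_apply, map_prod,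
    ← Finset.prod_mul_distrib]
  rw [Finset.prod_univ_sum, Fintype.piFinset_univ]

theorem productState_eq_zero_iff (v : ∀ p, EuclideanSpace ℂ (Fin (d p))) :
    productState v = 0 ↔ ∃ p, v p = 0 := by
  rw [← inner_self_eq_zero (𝕜 := ℂ), inner_productState, Finset.prod_eq_zero_iff]
  simp

theorem norm_productState_sq (v : ∀ p, EuclideanSpace ℂ (Fin (d p))) :
    ‖productState v‖ ^ 2 = ∏ p, ‖v p‖ ^ 2 := by
  have h := inner_productState v v
  simp only [inner_self_eq_norm_sq_to_K] at h
  exact_mod_cast h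

theorem applyLocal_productState (p : Fin m) (M : Matrix (Fin (d p)) (Fin (d p)) ℂ)
    (v : ∀ p, EuclideanSpace ℂ (Fin (d p))) :
    applyLocal p M (productState v) =
      productState (Function.update v p (toEuclideanLin M (v p))) := by
  ext x
  simp only [applyLocal, productState]
  rw [Fintype.prod_eq_mul_prod_compl p, Function.update_self]
  simp only [toLpLin_apply, mulVec, dotProduct, Finset.sum_mul]
  refine Finset.sum_congr rfl fun j _ => ?_
  rw [Fintype.prod_eq_mul_prod_compl p, Function.update_self, mul_assoc]
  congr 2
  refine Finset.prod_congr rfl fun q hq => ?_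
  have hq : q ≠ p := by simpa using hq
  rw [Function.update_of_ne hq, Function.update_of_ne hq]

theorem applyLocal_zero (p : Fin m) (M : Matrix (Fin (d p)) (Fin (d p)) ℂ) :
    applyLocal p M (0 : StateSpace d) = 0 := by
  ext x
  simp [applyLocal]

theorem inner_toEuclideanLin {n : ℕ} (M N : Matrix (Fin n) (Fin n) ℂ)
    (x y : EuclideanSpace ℂ (Fin n)) :
    inner ℂ (toEuclideanLin M x) (toEuclideanLin N y) =
      inner ℂ x (toEuclideanLin (Mᴴ * N) y) := by
  rw [← LinearMap.adjoint_inner_right, ← toEuclideanLin_conjTranspose_eq_adjoint]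
  simp [toLpLin_apply]

theorem sum_inner_toEuclideanLin {n k : ℕ} {M : Fin k → Matrix (Fin n) (Fin n) ℂ}
    (hM : ∑ i, (M i)ᴴ * M i = 1) (x y : EuclideanSpace ℂ (Fin n)) :
    ∑ i, inner ℂ (toEuclideanLin (M i) x) (toEuclideanLin (M i) y) = inner ℂ x y := by
  simp only [inner_toEuclideanLin, ← inner_sum]
  rw [← LinearMap.sum_apply, ← map_sum, hM]
  simp

/-- Only the factor at `p` changes, and there completeness of the measurement preserves the summed
inner product. -/
theorem sum_inner_applyLocal {p : Fin m} {k : ℕ} {M : Fin k → Matrix (Fin (d p)) (Fin (d p)) ℂ}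
    (hM : ∑ i, (M i)ᴴ * M i = 1) (v w : ∀ p, EuclideanSpace ℂ (Fin (d p))) :
    ∑ i, inner ℂ (applyLocal p (M i) (productState v)) (applyLocal p (M i) (productState w)) =
      inner ℂ (productState v) (productState w) := by
  simp only [applyLocal_productState, inner_productState]
  rw [Fintype.prod_eq_mul_prod_compl p, ← sum_inner_toEuclideanLin hM, Finset.sum_mul]
  refine Finset.sum_congr rfl fun i _ => ?_
  rw [Fintype.prod_eq_mul_prod_compl p, Function.update_self, Function.update_self]
  congr 1
  refine Finset.prod_congr rfl fun q hq => ?_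
  have hq : q ≠ p := by simpa using hq
  rw [Function.update_of_ne hq, Function.update_of_ne hq]

theorem sum_norm_applyLocal_sq {p : Fin m} {k : ℕ} {M : Fin k → Matrix (Fin (d p)) (Fin (d p)) ℂ}
    (hM : ∑ i, (M i)ᴴ * M i = 1) (v : ∀ p, EuclideanSpace ℂ (Fin (d p))) :
    ∑ i, ‖applyLocal p (M i) (productState v)‖ ^ 2 = ‖productState v‖ ^ 2 := by
  have h := sum_inner_applyLocal hM v v
  simp only [inner_self_eq_norm_sq_to_K] at h
  exact_mod_cast h

end ProductStates

/-! ### Perfect identification, branch by branch -/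

namespace Protocol

variable {m : ℕ} {d : Fin m → ℕ} {ι : Type} [DecidableEq ι]

theorem prob_le (P : Protocol d ι) (v : ∀ p, EuclideanSpace ℂ (Fin (d p))) (a : ι) :
    P.prob (productState v) a ≤ ‖productState v‖ ^ 2 := by
  induction P generalizing v with
  | output b =>
    rw [prob]
    split_ifs
    · exact le_rfl
    · positivity
  | measure p k M hM next ih =>
    rw [prob, ← sum_norm_applyLocal_sq hM]
    refine Finset.sum_le_sum fun i _ => ?_
    rw [applyLocal_productState]
    exact ih i _

/-- The protocol identifies each of the (not necessarily normalized) product states `v j`. -/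
def Identifies (P : Protocol d ι) (v : ι → ∀ p, EuclideanSpace ℂ (Fin (d p))) : Prop :=
  ∀ j, P.prob (productState (v j)) j = ‖productState (v j)‖ ^ 2

theorem identifies_measure_iff {p : Fin m} {k : ℕ} {M : Fin k → Matrix (Fin (d p)) (Fin (d p)) ℂ}
    {hM : ∑ i, (M i)ᴴ * M i = 1} {next : Fin k → Protocol d ι}
    {v : ι → ∀ p, EuclideanSpace ℂ (Fin (d p))} :
    (measure p k M hM next).Identifies v ↔ ∀ i, (next i).Identifies fun j =>
      Function.update (v j) p (toEuclideanLin (M i) (v j p)) := by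
  unfold Identifies
  rw [forall_comm]
  refine forall_congr' fun j => ?_
  rw [prob, ← sum_norm_applyLocal_sq hM]
  simp only [applyLocal_productState]
  -- Each summand is at most the squared norm of its branch, so equality of the sums forces equality
  -- in every branch.
  rw [Finset.sum_eq_sum_iff_of_le fun i _ => prob_le _ _ _]
  simp

/-- States that a protocol identifies are orthogonal. -/
theorem Identifies.inner_eq_zero {P : Protocol d ι}
    {v : ι → ∀ p, EuclideanSpace ℂ (Fin (d p))} (h : P.Identifies v) {j k : ι} (hjk : j ≠ k) :
    inner ℂ (productState (v j)) (productState (v k)) = 0 := by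
  induction P generalizing v with
  | output b =>
    have key : ∀ l, b ≠ l → productState (v l) = 0 := fun l hl => by
      have := h l
      rw [prob, if_neg hl] at this
      simpa using this.symm
    by_cases hb : b = j
    · rw [key k (hb ▸ hjk), inner_zero_right]
    · rw [key j hb, inner_zero_left]
  | measure p n M hM next ih =>
    -- The inner product is the sum of those after the outcomes, each zero by induction.
    rw [← sum_inner_applyLocal hM]
    refine Finset.sum_eq_zero fun i _ => ?_
    rw [applyLocal_productState, applyLocal_productState]
    exact ih i (v := fun l => Function.update (v l) p (toEuclideanLin (M i) (v l p)))
      (identifies_measure_iff.1 h i)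

end Protocol

/-! ### Projections onto lines, and distinguishability by them -/

section RankOne

variable {n : ℕ}

/-- The orthogonal projection onto the line through `u`, as a matrix. -/
noncomputable def lineProjection (u : EuclideanSpace ℂ (Fin n)) : Matrix (Fin n) (Fin n) ℂ :=
  (inner ℂ u u)⁻¹ • vecMulVec u (star (u : Fin n → ℂ))

theorem toEuclideanLin_lineProjection (u x : EuclideanSpace ℂ (Fin n)) :
    toEuclideanLin (lineProjection u) x = ((inner ℂ u u)⁻¹ * inner ℂ u x) • u := by
  ext i
  simp only [lineProjection, toLpLin_apply, smul_mulVec, vecMulVec_mulVec,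
    EuclideanSpace.inner_eq_star_dotProduct]
  simp [dotProduct_comm, mul_assoc, mul_comm]

theorem conjTranspose_lineProjection (u : EuclideanSpace ℂ (Fin n)) :
    (lineProjection u)ᴴ = lineProjection u := by
  rw [lineProjection, conjTranspose_smul, conjTranspose_vecMulVec, star_star, RCLike.star_def,
    map_inv₀, inner_conj_symm]

theorem lineProjection_mul_self {u : EuclideanSpace ℂ (Fin n)} (hu : u ≠ 0) :
    lineProjection u * lineProjection u = lineProjection u := by
  apply toEuclideanLin.injective
  ext1 x
  have h : toEuclideanLin (lineProjection u * lineProjection u) x =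
      toEuclideanLin (lineProjection u) (toEuclideanLin (lineProjection u) x) := by
    simp [toLpLin_apply]
  have h0 : inner ℂ u u ≠ 0 := inner_self_ne_zero.2 hu
  rw [h, toEuclideanLin_lineProjection, toEuclideanLin_lineProjection, inner_smul_right]
  congr 1
  field_simp

theorem lineProjection_complete {u : EuclideanSpace ℂ (Fin n)} (hu : u ≠ 0) :
    ∑ i, (![lineProjection u, 1 - lineProjection u] i)ᴴ *
      ![lineProjection u, 1 - lineProjection u] i = 1 := by
  simp only [Fin.sum_univ_two, cons_val_zero, cons_val_one, conjTranspose_sub, conjTranspose_one,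
    conjTranspose_lineProjection, mul_sub, sub_mul, lineProjection_mul_self hu, one_mul, mul_one]
  abel

end RankOne

/-- A sufficient criterion for local distinguishability of the states in the list `S`, where any two
states `j` and `k` are orthogonal on the subsystem `c j k`: on some subsystem `p`, some state `s`
can be projected on, and the criterion holds after either outcome. The recursion depth is bounded
by the first argument. -/
def reducible {κ γ : Type} [DecidableEq κ] [DecidableEq γ] (parties : List γ) (c : κ → κ → γ) :
    ℕ → List κ → Bool
  | 0, S => S.length ≤ 1
  | n + 1, S => S.length ≤ 1 || parties.any fun p => S.any fun s =>
      (S.all fun k => S.all fun l => k = l || c k l ≠ p || (k ≠ s && c s k = p) ||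
        (l ≠ s && c s l = p)) &&
      reducible parties c n (S.filter fun k => k ≠ s) &&
      reducible parties c n (S.filter fun k => k = s || c s k ≠ p)

section Reduction

variable {m : ℕ} {d : Fin m → ℕ} {ι κ γ : Type} [DecidableEq ι]

theorem exists_identifies_of_length_le_one [Nonempty ι] (σ : ι ≃ κ) {S : List κ}
    (hS : S.length ≤ 1) (v : ι → ∀ p, EuclideanSpace ℂ (Fin (d p)))
    (hv : ∀ j, σ j ∉ S → productState (v j) = 0) : ∃ P : Protocol d ι, P.Identifies v := by
  obtain ⟨a, ha⟩ : ∃ a : ι, ∀ j, j ≠ a → σ j ∉ S := by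
    match S, hS with
    | [], _ => exact ⟨Classical.arbitrary ι, by simp⟩
    | [s], _ => exact ⟨σ.symm s, fun j hj h =>
      hj ((Equiv.eq_symm_apply σ).2 (by simpa using h))⟩
  refine ⟨.output a, fun j => ?_⟩
  rw [Protocol.prob]
  split_ifs with h
  · rfl
  · rw [hv j (ha j (Ne.symm h))]
    simp

/-- Eliminated states are kept in the family as zero vectors; `S` lists those still possible. Norms
are not assumed, so the hypotheses are stable under measurement. -/
theorem exists_identifies_of_reducible [Nonempty ι] [DecidableEq κ] [DecidableEq γ]
    {parties : List γ} {c : κ → κ → γ} {τ : γ → Fin m} (hτ : Function.Injective τ) (σ : ι ≃ κ)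
    (n : ℕ) {S : List κ} (hS : reducible parties c n S = true) (v : ι → ∀ p, EuclideanSpace ℂ (Fin (d p)))
    (hv : ∀ j, σ j ∉ S → productState (v j) = 0)
    (horth : ∀ j k, σ j ∈ S → σ k ∈ S → j ≠ k →
      inner ℂ (v j (τ (c (σ j) (σ k)))) (v k (τ (c (σ j) (σ k)))) = 0) :
    ∃ P : Protocol d ι, P.Identifies v := by
  induction n generalizing S v with
  | zero => exact exists_identifies_of_length_le_one σ (by simpa [reducible] using hS) v hv
  | succ n ih =>
    rw [reducible, Bool.or_eq_true] at hS
    rcases hS with hS | hS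
    · exact exists_identifies_of_length_le_one σ (by simpa using hS) v hv
    simp only [List.any_eq_true, Bool.and_eq_true, List.all_eq_true] at hS
    obtain ⟨p, -, s, hs, ⟨hcover, h₁⟩, h₂⟩ := hS
    replace hcover : ∀ k ∈ S, ∀ l ∈ S, k ≠ l → c k l = p →
        (k ≠ s ∧ c s k = p) ∨ (l ≠ s ∧ c s l = p) := by
      intro k hk l hl hkl hc
      have := hcover k hk l hl
      simpa [hkl, hc] using this
    obtain ⟨j₀, rfl⟩ := σ.surjective s
    have hneighbour : ∀ k, σ k ∈ S → σ k ≠ σ j₀ → c (σ j₀) (σ k) = p →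
        inner ℂ (v j₀ (τ p)) (v k (τ p)) = 0 := fun k hk hne hc => by
      have := horth j₀ k hs hk (fun h => hne (by rw [h]))
      rwa [hc] at this
    -- A vanishing factor means that the state is already eliminated, and no measurement is needed.
    by_cases hu : v j₀ (τ p) = 0
    · refine ih h₁ v (fun j hj => ?_) fun j k hj hk => ?_
      · by_cases hj' : σ j ∈ S
        · have : j = j₀ := by simpa [hj'] using hj
          exact (productState_eq_zero_iff _).2 ⟨τ p, this ▸ hu⟩
        · exact hv j hj'
      · exact horth j k (List.mem_of_mem_filter hj) (List.mem_of_mem_filter hk)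
    set u := v j₀ (τ p) with hu_def
    have hzero : ∀ (M : Matrix (Fin (d (τ p))) (Fin (d (τ p))) ℂ) j, σ j ∉ S →
        productState (Function.update (v j) (τ p) (toEuclideanLin M (v j (τ p)))) = 0 :=
      fun M j hj => by rw [← applyLocal_productState, hv j hj, applyLocal_zero]
    obtain ⟨P₂, hP₂⟩ := ih h₂ (fun j => Function.update (v j) (τ p)
      (toEuclideanLin (lineProjection u) (v j (τ p)))) (fun j hj => by
        by_cases hjS : σ j ∈ S
        · have hj' : σ j ≠ σ j₀ ∧ c (σ j₀) (σ j) = p := by simpa [hjS] using hj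
          refine (productState_eq_zero_iff _).2 ⟨τ p, ?_⟩
          rw [Function.update_self, toEuclideanLin_lineProjection,
            hneighbour j hjS hj'.1 hj'.2, mul_zero, zero_smul]
        · exact hzero _ j hjS) (fun j k hj hk hjk => by
        have hjS := List.mem_of_mem_filter hj
        have hkS := List.mem_of_mem_filter hk
        -- Of two states orthogonal at `p`, one is annihilated by the projection, so survivors are
        -- orthogonal elsewhere.
        have hc : c (σ j) (σ k) ≠ p := fun hc => by
          have hj' := List.of_mem_filter hj
          have hk' := List.of_mem_filter hk
          have := hcover _ hjS _ hkS (σ.injective.ne hjk) hc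
          simp only [Bool.or_eq_true, decide_eq_true_eq] at hj' hk'
          tauto
        have hc := hτ.ne hc
        simp only [Function.update_of_ne hc]
        exact horth j k hjS hkS hjk)
    obtain ⟨P₁, hP₁⟩ := ih h₁ (fun j => Function.update (v j) (τ p)
      (toEuclideanLin (1 - lineProjection u) (v j (τ p)))) (fun j hj => by
        by_cases hjS : σ j ∈ S
        · have : j = j₀ := by simpa [hjS] using hj
          subst this
          refine (productState_eq_zero_iff _).2 ⟨τ p, ?_⟩
          rw [Function.update_self, map_sub, LinearMap.sub_apply, toEuclideanLin_lineProjection,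
            ← hu_def, inv_mul_cancel₀ (inner_self_ne_zero.2 hu)]
          simp
        · exact hzero _ j hjS) (fun j k hj hk hjk => by
        have hjS := List.mem_of_mem_filter hj
        have hkS := List.mem_of_mem_filter hk
        have h0 := horth j k hjS hkS hjk
        by_cases hc : c (σ j) (σ k) = p
        · rw [hc] at h0 ⊢
          -- The complement changes the inner product of `x` and `y` by a multiple of `⟨x, u⟩ * ⟨u,
          -- y⟩`, which vanishes here.
          have hor : inner ℂ (v j (τ p)) u = 0 ∨ inner ℂ u (v k (τ p)) = 0 := by
            rcases hcover _ hjS _ hkS (σ.injective.ne hjk) hc with h | h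
            · exact .inl (inner_eq_zero_symm.1 (hneighbour j hjS h.1 h.2))
            · exact .inr (hneighbour k hkS h.1 h.2)
          simp only [Function.update_self]
          rw [inner_toEuclideanLin, conjTranspose_sub, conjTranspose_one,
            conjTranspose_lineProjection, mul_sub, mul_one, sub_mul, one_mul,
            lineProjection_mul_self hu, sub_self, sub_zero, map_sub, LinearMap.sub_apply,
            toEuclideanLin_lineProjection, inner_sub_right, inner_smul_right]
          rcases hor with h | h <;> simp [h, h0]
        · have hc := hτ.ne hc
          simp only [Function.update_of_ne hc]
          exact h0)
    refine ⟨.measure (τ p) 2 ![lineProjection u, 1 - lineProjection u]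
      (lineProjection_complete hu) ![P₂, P₁], Protocol.identifies_measure_iff.2 ?_⟩
    rw [Fin.forall_fin_two]
    exact ⟨hP₂, hP₁⟩

end Reduction

/-! ### Rigidity of orthogonality-preserving operations -/

section Indistinguishability

variable {m : ℕ} {d : Fin m → ℕ} {ι : Type} [DecidableEq ι]

/-- A criterion for local indistinguishability. Any local operation that keeps the states orthogonal
acts, as far as the states are concerned, through an operator `F` of a fixed class `K p`, and such
an operator with a positive distinguished diagonal entry eliminates neither `j₀` nor `j₁`. -/
theorem not_identifies {v : ι → ∀ p, EuclideanSpace ℂ (Fin (d p))} {o : ∀ p, Fin (d p)}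
    {K : ∀ p, Set (Matrix (Fin (d p)) (Fin (d p)) ℂ)}
    (hone : ∀ p, 1 ∈ K p) (R : Fin m → List (ι × ι)) (hR : ∀ p, ∀ e ∈ R p, e.1 ≠ e.2)
    (hrigid : ∀ p F, F.PosSemidef →
      (∀ e ∈ R p, inner ℂ (v e.1 p) (toEuclideanLin F (v e.2 p)) = 0) → F ∈ K p)
    (hother : ∀ p, ∀ e ∈ R p, ∀ q, q ≠ p → ∀ F ∈ K q, F.PosSemidef → 0 < (F (o q) (o q)).re →
      inner ℂ (v e.1 q) (toEuclideanLin F (v e.2 q)) ≠ 0)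
    {j₀ j₁ : ι} (hj : j₀ ≠ j₁)
    (hpos : ∀ j, j = j₀ ∨ j = j₁ → ∀ q, ∀ F ∈ K q, F.PosSemidef → 0 < (F (o q) (o q)).re →
      inner ℂ (v j q) (toEuclideanLin F (v j q)) ≠ 0)
    (P : Protocol d ι) : ¬ P.Identifies v := by
  -- Induction over the protocol needs the operators `T` accumulated along a branch; the start is `T
  -- = 1`.
  suffices H : ∀ T : ∀ p, Matrix (Fin (d p)) (Fin (d p)) ℂ, (∀ p, (T p)ᴴ * T p ∈ K p) →
      (∀ p, 0 < (((T p)ᴴ * T p) (o p) (o p)).re) →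
      ¬ P.Identifies fun j p => toEuclideanLin (T p) (v j p) by
    have := H (fun _ => 1) (by simpa using hone) (by simp)
    simpa using this
  intro T hK hT h
  induction P generalizing T with
  | output b =>
    -- One of the two surviving states differs from the answer, hence would have to be zero.
    obtain ⟨j, hjb, hj'⟩ : ∃ j, b ≠ j ∧ (j = j₀ ∨ j = j₁) := by
      by_cases hb : b = j₀
      · exact ⟨j₁, hb ▸ hj, .inr rfl⟩
      · exact ⟨j₀, hb, .inl rfl⟩
    have h1 := h j
    rw [Protocol.prob, if_neg hjb, eq_comm, sq_eq_zero_iff, norm_eq_zero,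
      productState_eq_zero_iff] at h1
    obtain ⟨q, hq⟩ := h1
    refine hpos j hj' q _ (hK q) (posSemidef_conjTranspose_mul_self _) (hT q) ?_
    rw [← inner_toEuclideanLin]
    exact inner_self_eq_zero.2 hq
  | measure p n M hM next ih =>
    have hsum : ∑ i, (((M i * T p)ᴴ * (M i * T p)) (o p) (o p)).re =
        (((T p)ᴴ * T p) (o p) (o p)).re := by
      rw [← Complex.re_sum, ← Matrix.sum_apply]
      congr 3
      have : ∀ i, (M i * T p)ᴴ * (M i * T p) = (T p)ᴴ * ((M i)ᴴ * M i) * T p := fun i => by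
        rw [conjTranspose_mul]
        simp only [Matrix.mul_assoc]
      simp only [this]
      rw [← Matrix.sum_mul, ← Matrix.mul_sum, hM, Matrix.mul_one]
    -- The distinguished entries over all outcomes sum to the previous positive one, so some outcome
    -- keeps it positive.
    obtain ⟨i, -, hi⟩ := Finset.exists_lt_of_sum_lt (s := Finset.univ) (f := fun _ : Fin n => (0 : ℝ))
      (by rw [hsum]; simpa using hT p)
    have hnext : (next i).Identifies fun j q =>
        toEuclideanLin (Function.update T p (M i * T p) q) (v j q) := by
      convert Protocol.identifies_measure_iff.1 h i using 1
      funext j q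
      by_cases hq : q = p
      · subst hq
        simp [toLpLin_apply]
      · simp [hq]
    refine ih i _ (fun q => ?_) (fun q => ?_) hnext
    · by_cases hq : q = p
      · subst hq
        refine hrigid q _ (posSemidef_conjTranspose_mul_self _) fun e he => ?_
        have h0 := hnext.inner_eq_zero (hR q e he)
        rw [inner_productState, Finset.prod_eq_zero_iff] at h0
        obtain ⟨r, -, hr⟩ := h0
        rw [inner_toEuclideanLin] at hr
        -- The pair is still orthogonal somewhere; `hother` excludes every party but the measuring
        -- one.
        by_cases hrq : r = q
        · exact hrq ▸ hr
        · rw [Function.update_of_ne hrq] at hr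
          exact absurd hr
            (hother q e he r hrq _ (hK r) (posSemidef_conjTranspose_mul_self _) (hT r))
      · rw [Function.update_of_ne hq]
        exact hK q
    · by_cases hq : q = p
      · subst hq
        rw [Function.update_self]
        exact hi
      · rw [Function.update_of_ne hq]
        exact hT q

end Indistinguishability

/-! ### Indistinguishable states for the two exceptional graphs -/

section Qutrits

/-- The vector in `ℂ^3` with the coordinates `x i / N`. -/
noncomputable def gaussianVector (N : ℕ) (x : Fin 3 → GaussianInt) : EuclideanSpace ℂ (Fin 3) :=
  WithLp.toLp 2 fun i => GaussianInt.toComplex (x i) / N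

theorem inner_gaussianVector (N : ℕ) (x y : Fin 3 → GaussianInt) :
    inner ℂ (gaussianVector N x) (gaussianVector N y) =
      GaussianInt.toComplex (∑ i, star (x i) * y i) / N ^ 2 := by
  simp only [gaussianVector, PiLp.inner_apply, RCLike.inner_apply, map_sum, map_mul,
    GaussianInt.toComplex_star, map_div₀, Complex.conj_natCast, Finset.sum_div]
  exact Finset.sum_congr rfl fun i _ => by ring

theorem norm_gaussianVector {N : ℕ} (hN : N ≠ 0) {x : Fin 3 → GaussianInt}
    (hx : ∑ i, star (x i) * x i = N ^ 2) : ‖gaussianVector N x‖ = 1 := by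
  have hN' : (N : ℂ) ≠ 0 := Nat.cast_ne_zero.2 hN
  have h := inner_gaussianVector N x x
  rw [hx, inner_self_eq_norm_sq_to_K] at h
  simp only [map_pow, map_natCast] at h
  rw [div_self (pow_ne_zero 2 hN')] at h
  have h1 : ‖gaussianVector N x‖ ^ 2 = 1 := Complex.ofReal_injective (by simpa using h)
  exact (pow_eq_one_iff_of_nonneg (norm_nonneg _) two_ne_zero).1 h1

theorem inner_gaussianVector_eq_zero_iff {N : ℕ} (hN : N ≠ 0) (x y : Fin 3 → GaussianInt) :
    inner ℂ (gaussianVector N x) (gaussianVector N y) = 0 ↔ ∑ i, star (x i) * y i = 0 := by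
  rw [inner_gaussianVector, div_eq_zero_iff, GaussianInt.toComplex_eq_zero]
  simp [hN]

theorem inner_toEuclideanLin_gaussianVector (N : ℕ) (x y : Fin 3 → GaussianInt)
    (F : Matrix (Fin 3) (Fin 3) ℂ) :
    inner ℂ (gaussianVector N x) (toEuclideanLin F (gaussianVector N y)) =
      (∑ a, ∑ b, F a b * (star (x a) * y b : GaussianInt)) / N ^ 2 := by
  simp only [gaussianVector, PiLp.inner_apply, RCLike.inner_apply, toLpLin_apply, mulVec,
    dotProduct, map_mul, GaussianInt.toComplex_star, map_div₀, Complex.conj_natCast,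
    Finset.sum_div, Finset.sum_mul]
  exact Finset.sum_congr rfl fun i _ => Finset.sum_congr rfl fun j _ => by ring

/-- The operators that act on the first two coordinates as a scalar, and, if `block` holds, do not
mix them with the third coordinate. -/
def scalarOnPlane (block : Prop) : Set (Matrix (Fin 3) (Fin 3) ℂ) :=
  {F | F 0 0 = F 1 1 ∧ F 0 1 = 0 ∧ F 1 0 = 0 ∧
    (block → F 0 2 = 0 ∧ F 1 2 = 0 ∧ F 2 0 = 0 ∧ F 2 1 = 0)}

theorem one_mem_scalarOnPlane (block : Prop) : 1 ∈ scalarOnPlane block := by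
  simp [scalarOnPlane]

theorem mem_scalarOnPlane_of_isHermitian {F : Matrix (Fin 3) (Fin 3) ℂ} (hF : F.IsHermitian)
    {block : Prop} (h11 : F 0 0 = F 1 1) (h10 : F 1 0 = 0)
    (hblock : block → F 2 0 = 0 ∧ F 2 1 = 0) : F ∈ scalarOnPlane block := by
  refine ⟨h11, ?_, h10, fun hb => ⟨?_, ?_, hblock hb⟩⟩
  · rw [← hF.apply, h10, star_zero]
  · rw [← hF.apply, (hblock hb).1, star_zero]
  · rw [← hF.apply, (hblock hb).2, star_zero]

/-- Coordinates of vectors that no operator of the class `scalarOnPlane block` with positive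
diagonal makes orthogonal. -/
abbrev StaysNonorthogonal (block : Prop) (x y : Fin 3 → GaussianInt) : Prop :=
  (block ∨ (x 2 = 0 ∧ y 2 = 0)) ∧
    ((star (x 0) * y 0 + star (x 1) * y 1 ≠ 0 ∧ star (x 2) * y 2 = 0) ∨
      (0 < (star (x 0) * y 0 + star (x 1) * y 1).re ∧ 0 ≤ (star (x 2) * y 2).re))

/-- Up to `N ^ 2` the inner product is `F 0 0 * s + F 2 2 * t`, with `s` from the plane and `t` from
the third axis. As `F 2 2` may be any nonnegative number, either `t = 0`, or the real parts must not
cancel. -/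
theorem inner_ne_zero_of_mem_scalarOnPlane {N : ℕ} (hN : N ≠ 0) {block : Prop}
    {F : Matrix (Fin 3) (Fin 3) ℂ} (hF : F ∈ scalarOnPlane block) (hpsd : F.PosSemidef)
    (h00 : 0 < (F 0 0).re) {x y : Fin 3 → GaussianInt} (h : StaysNonorthogonal block x y) :
    inner ℂ (gaussianVector N x) (toEuclideanLin F (gaussianVector N y)) ≠ 0 := by
  obtain ⟨hblock, h⟩ := h
  have hN' : (N : ℂ) ^ 2 ≠ 0 := pow_ne_zero 2 (Nat.cast_ne_zero.2 hN)
  obtain ⟨h11, h01, h10, hb⟩ := hF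
  have hsum : ∑ a, ∑ b, F a b * (star (x a) * y b : GaussianInt) =
      F 0 0 * (star (x 0) * y 0 + star (x 1) * y 1 : GaussianInt) +
      F 2 2 * (star (x 2) * y 2 : GaussianInt) := by
    simp only [Fin.sum_univ_three, h01, h10, ← h11]
    rcases hblock with hblock | ⟨hx, hy⟩
    · obtain ⟨h02, h12, h20, h21⟩ := hb hblock
      simp only [h02, h12, h20, h21, map_add]
      ring
    · simp [hx, hy, mul_add]
  rw [inner_toEuclideanLin_gaussianVector, hsum]
  refine div_ne_zero ?_ hN'
  have h00' : F 0 0 ≠ 0 := fun h0 => by simp [h0] at h00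
  rcases h with ⟨hs, ht⟩ | ⟨hs, ht⟩
  · rw [ht, map_zero, mul_zero, add_zero]
    exact mul_ne_zero h00' (mt GaussianInt.toComplex_eq_zero.1 hs)
  · have him : ∀ i, (F i i).im = 0 := fun i =>
      Complex.conj_eq_iff_im.1 (hpsd.isHermitian.apply i i)
    have h22 : 0 ≤ (F 2 2).re := (Complex.le_def.1 (hpsd.diag_nonneg (i := 2))).1
    intro h0
    have h1 := congrArg Complex.re h0
    rw [Complex.add_re, Complex.mul_re, Complex.mul_re, him, him, ← GaussianInt.intCast_re,
      ← GaussianInt.intCast_re] at h1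
    simp only [zero_mul, sub_zero, Complex.zero_re] at h1
    have hs' : (0 : ℝ) < (star (x 0) * y 0 + star (x 1) * y 1).re := by exact_mod_cast hs
    have ht' : (0 : ℝ) ≤ (star (x 2) * y 2).re := by exact_mod_cast ht
    have := mul_pos h00 hs'
    have := mul_nonneg h22 ht'
    linarith

/-- Coordinates, times `25`, of five product states of three qutrits with the orthogonality graph
`graphPath`. -/
def pathCoordinates : Fin 3 → Fin 5 → Fin 3 → GaussianInt :=
  ![![![0, 15, 20], ![-12, 9, 20], ![0, 0, 25], ![25, 0, 0], ![15, 20, 0]],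
    ![![25, 0, 0], ![15, 20, 0], ![0, 25, 0], ![20, -15, 0], ![0, 25, 0]],
    ![![25, 0, 0], ![0, 25, 0], ![25, 0, 0], ![15, 20, 0], ![20, -15, 0]]]

/-- Coordinates, times `15`, of five product states of three qutrits with the orthogonality graph
`graphTriangle`. -/
def triangleCoordinates : Fin 3 → Fin 5 → Fin 3 → GaussianInt :=
  ![![![5, 10, 10], ![⟨-6, -12⟩, 3, ⟨0, 6⟩], ![0, 0, 15], ![15, 0, 0], ![0, 15, 0]],
    ![![15, 0, 0], ![9, 12, 0], ![0, 15, 0], ![0, 15, 0], ![12, -9, 0]],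
    ![![15, 0, 0], ![9, 12, 0], ![12, -9, 0], ![12, -9, 0], ![0, 15, 0]]]

/-- Five product states of three qutrits with the orthogonality graph `graphPath`. -/
noncomputable def pathStates (j : Fin 5) (p : Fin 3) : EuclideanSpace ℂ (Fin 3) :=
  gaussianVector 25 (pathCoordinates p j)

/-- Five product states of three qutrits with the orthogonality graph `graphTriangle`. -/
noncomputable def triangleStates (j : Fin 5) (p : Fin 3) : EuclideanSpace ℂ (Fin 3) :=
  gaussianVector 15 (triangleCoordinates p j)

theorem norm_pathStates (j : Fin 5) (p : Fin 3) : ‖pathStates j p‖ = 1 :=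
  norm_gaussianVector (by norm_num) (by revert j p; decide +kernel)

theorem norm_triangleStates (j : Fin 5) (p : Fin 3) : ‖triangleStates j p‖ = 1 :=
  norm_gaussianVector (by norm_num) (by revert j p; decide +kernel)

theorem orthogonalityGraph_pathStates :
    orthogonalityGraph (d := fun _ => 3) pathStates = graphPath := by
  have h : ∀ p j k, (orthogonalityGraph (d := fun _ => 3) pathStates p).Adj j k ↔
      j ≠ k ∧ ∑ i, star (pathCoordinates p j i) * pathCoordinates p k i = 0 := fun p j k =>
    and_congr_right fun _ => inner_gaussianVector_eq_zero_iff (by norm_num) _ _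
  funext p
  ext j k
  rw [h]
  fin_cases p <;> revert j k <;> simp [graphPath] <;> decide +kernel

theorem orthogonalityGraph_triangleStates :
    orthogonalityGraph (d := fun _ => 3) triangleStates = graphTriangle := by
  have h : ∀ p j k, (orthogonalityGraph (d := fun _ => 3) triangleStates p).Adj j k ↔
      j ≠ k ∧ ∑ i, star (triangleCoordinates p j i) * triangleCoordinates p k i = 0 :=
    fun p j k => and_congr_right fun _ => inner_gaussianVector_eq_zero_iff (by norm_num) _ _
  funext p
  ext j k
  rw [h]
  fin_cases p <;> revert j k <;> simp [graphTriangle] <;> decide +kernel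

theorem sum_eq_zero_of_inner_eq_zero {N : ℕ} (hN : N ≠ 0) {x y : Fin 3 → GaussianInt}
    {F : Matrix (Fin 3) (Fin 3) ℂ}
    (h : inner ℂ (gaussianVector N x) (toEuclideanLin F (gaussianVector N y)) = 0) :
    ∑ a, ∑ b, F a b * (star (x a) * y b : GaussianInt) = 0 := by
  rw [inner_toEuclideanLin_gaussianVector] at h
  exact (div_eq_zero_iff.1 h).resolve_right (pow_ne_zero 2 (Nat.cast_ne_zero.2 hN))

/-- Projected to the plane, states 0, 1, 3, 4 give each party two orthogonal pairs in different
directions, which force a scalar. The third axis of party 0 carries state 2 and lets it overlap with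
states 0 and 1. -/
theorem not_identifies_pathStates (P : Protocol (fun _ : Fin 3 => 3) (Fin 5)) :
    ¬ P.Identifies pathStates := by
  -- The edges from 2 to 0 and 1 are left out: party 0 can make these pairs orthogonal by
  -- annihilating the third axis.
  refine not_identifies (o := fun _ => 0) (K := fun p => scalarOnPlane (p = 0))
    (fun p => one_mem_scalarOnPlane _) ![[(2, 3), (2, 4), (0, 3), (4, 1)], [(0, 4), (1, 3)],
      [(0, 1), (3, 4)]] (by decide) (fun p F hpsd h => ?_)
    (fun p e he q hq F hF hpsd h00 => ?_) (j₀ := 3) (j₁ := 4) (by decide)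
    (fun j hj q F hF hpsd h00 => ?_) P
  · replace h := fun e he => sum_eq_zero_of_inner_eq_zero (by norm_num) (h e he)
    have hF := hpsd.isHermitian
    fin_cases p
    all_goals
      simp [pathCoordinates, Fin.sum_univ_three, GaussianInt.toComplex_def] at h
    · obtain ⟨h₁, h₂, h₃, h₄⟩ := h
      have h21 : F 2 1 = 0 := by linear_combination h₂ / 500 - 3 / 4 * h₁
      have h10 : F 1 0 = 0 := by linear_combination h₃ / 375 - 4 / 3 * h₁
      have h01 : F 0 1 = 0 := by rw [← hF.apply, h10, star_zero]
      have h02 : F 0 2 = 0 := by rw [← hF.apply, h₁, star_zero]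
      have h12 : F 1 2 = 0 := by rw [← hF.apply, h21, star_zero]
      refine mem_scalarOnPlane_of_isHermitian hF ?_ h10 fun _ => ⟨h₁, h21⟩
      rw [h01, h02, h12, h10] at h₄
      linear_combination -h₄ / 180
    all_goals
      obtain ⟨h₀, h₁⟩ := h
      have h10 : F 1 0 = 0 := by rw [← hF.apply, h₀, star_zero]
      refine mem_scalarOnPlane_of_isHermitian hF ?_ h10 (by simp)
      linear_combination h₁ / 300 + 3 / 4 * h₀ - 4 / 3 * h10
  · have key : StaysNonorthogonal (q = 0) (pathCoordinates q e.1) (pathCoordinates q e.2) := by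
      clear h00 hpsd hF F
      revert p e q
      decide +kernel
    exact inner_ne_zero_of_mem_scalarOnPlane (by norm_num) hF hpsd h00 key
  · have key : StaysNonorthogonal (q = 0) (pathCoordinates q j) (pathCoordinates q j) := by
      clear h00 hpsd hF F
      revert j q
      decide +kernel
    exact inner_ne_zero_of_mem_scalarOnPlane (by norm_num) hF hpsd h00 key

theorem not_identifies_triangleStates (P : Protocol (fun _ : Fin 3 => 3) (Fin 5)) :
    ¬ P.Identifies triangleStates := by
  refine not_identifies (o := fun _ => 0) (K := fun p => scalarOnPlane (p = 0))
    (fun p => one_mem_scalarOnPlane _) ![[(3, 4), (2, 3), (2, 4), (0, 1)], [(0, 3), (1, 4)],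
      [(0, 4), (1, 3)]] (by decide) (fun p F hpsd h => ?_)
    (fun p e he q hq F hF hpsd h00 => ?_) (j₀ := 3) (j₁ := 4) (by decide)
    (fun j hj q F hF hpsd h00 => ?_) P
  · replace h := fun e he => sum_eq_zero_of_inner_eq_zero (by norm_num) (h e he)
    have hF := hpsd.isHermitian
    fin_cases p
    all_goals
      simp [triangleCoordinates, Fin.sum_univ_three, GaussianInt.toComplex_def] at h
    · obtain ⟨h01, h20, h21, h₄⟩ := h
      have h10 : F 1 0 = 0 := by rw [← hF.apply, h01, star_zero]
      have h02 : F 0 2 = 0 := by rw [← hF.apply, h20, star_zero]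
      have h12 : F 1 2 = 0 := by rw [← hF.apply, h21, star_zero]
      refine mem_scalarOnPlane_of_isHermitian hF ?_ h10 fun _ => ⟨h20, h21⟩
      have him : ∀ i, (F i i).im = 0 := fun i => Complex.conj_eq_iff_im.1 (hF.apply i i)
      rw [h01, h02, h12, h10, h20, h21] at h₄
      -- States 0 and 1 are orthogonal at party 0 although both overlap with state 2. The complex
      -- coordinates make the coefficient of `F 2 2` imaginary, so the real part compares `F 0 0`
      -- with `F 1 1` alone.
      have hre := congrArg Complex.re h₄
      simp [him] at hre
      refine Complex.ext ?_ (by rw [him, him])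
      linarith
    all_goals
      obtain ⟨h₀, h₁⟩ := h
      have h10 : F 1 0 = 0 := by rw [← hF.apply, h₀, star_zero]
      refine mem_scalarOnPlane_of_isHermitian hF ?_ h10 (by simp)
      linear_combination h₁ / 108 + 3 / 4 * h₀ - 4 / 3 * h10
  · have key : StaysNonorthogonal (q = 0) (triangleCoordinates q e.1) (triangleCoordinates q e.2) := by
      clear h00 hpsd hF F
      revert p e q
      decide +kernel
    exact inner_ne_zero_of_mem_scalarOnPlane (by norm_num) hF hpsd h00 key
  · have key : StaysNonorthogonal (q = 0) (triangleCoordinates q j) (triangleCoordinates q j) := by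
      clear h00 hpsd hF F
      revert j q
      decide +kernel
    exact inner_ne_zero_of_mem_scalarOnPlane (by norm_num) hF hpsd h00 key

end Qutrits

/-! ### Graphs on five vertices as ten-bit masks -/

section Masks

/-- The number of the edge between `j` and `k` of the complete graph on five vertices. -/
def edgeIndex (j k : Fin 5) : ℕ :=
  (max j k).val * ((max j k).val - 1) / 2 + (min j k).val

/-- The end points of the edges of the complete graph on five vertices, in the order of
`edgeIndex`. -/
def endpoints : Fin 10 → Fin 5 × Fin 5 :=
  ![(0, 1), (0, 2), (1, 2), (0, 3), (1, 3), (2, 3), (0, 4), (1, 4), (2, 4), (3, 4)]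

theorem edgeIndex_comm (j k : Fin 5) : edgeIndex j k = edgeIndex k j := by
  rw [edgeIndex, edgeIndex, max_comm, min_comm]

theorem exists_endpoints {j k : Fin 5} (h : j ≠ k) :
    ∃ e : Fin 10, edgeIndex j k = e ∧ (endpoints e = (j, k) ∨ endpoints e = (k, j)) := by
  revert j k
  decide

theorem endpoints_ne (e : Fin 10) : (endpoints e).1 ≠ (endpoints e).2 := by
  revert e
  decide

theorem edgeIndex_endpoints (e : Fin 10) : edgeIndex (endpoints e).1 (endpoints e).2 = e := by
  revert e
  decide

/-- The set of the edges of `H`, as a bit mask. -/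
noncomputable def edgeMask (H : SimpleGraph (Fin 5)) : ℕ :=
  open Classical in Nat.ofBits fun e : Fin 10 => decide (H.Adj (endpoints e).1 (endpoints e).2)

/-- The mask obtained from `a` by relabelling the vertices. -/
def relabelMask (s : Fin 5 → Fin 5) (a : ℕ) : ℕ :=
  Nat.ofBits fun e : Fin 10 => a.testBit (edgeIndex (s (endpoints e).1) (s (endpoints e).2))

/-- The mask of the edges in neither `a` nor `b`. -/
def restMask (a b : ℕ) : ℕ :=
  Nat.ofBits fun e : Fin 10 => !a.testBit e && !b.testBit e

/-- The number of edges in a mask. -/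
def maskCard (a : ℕ) : ℕ := (List.range 10).countP a.testBit

theorem testBit_edgeMask (H : SimpleGraph (Fin 5)) {j k : Fin 5} (h : j ≠ k) :
    (edgeMask H).testBit (edgeIndex j k) = true ↔ H.Adj j k := by
  obtain ⟨e, he, h'⟩ := exists_endpoints h
  rw [edgeMask, he, Nat.testBit_ofBits_lt _ _ e.isLt]
  rcases h' with h' | h' <;> simp [h', H.adj_comm]

theorem edgeMask_lt (H : SimpleGraph (Fin 5)) : edgeMask H < 1024 :=
  Nat.ofBits_lt_two_pow _

theorem edgeMask_comap (H : SimpleGraph (Fin 5)) {s : Fin 5 → Fin 5} (hs : Function.Injective s) :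
    edgeMask (H.comap s) = relabelMask s (edgeMask H) := by
  rw [relabelMask, edgeMask]
  congr 1
  funext e
  rw [Bool.eq_iff_iff, testBit_edgeMask H (hs.ne (endpoints_ne e))]
  simp

theorem two_mul_ncard_edgeSet {n : ℕ} (H : SimpleGraph (Fin n)) [DecidableRel H.Adj] :
    2 * H.edgeSet.ncard = ∑ j, ∑ k, if H.Adj j k then 1 else 0 := by
  rw [← H.coe_edgeFinset, Set.ncard_coe_finset, ← H.sum_degrees_eq_twice_card_edges]
  refine Finset.sum_congr rfl fun j _ => ?_
  rw [← H.card_neighborFinset_eq_degree, H.neighborFinset_eq_filter, Finset.card_filter]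

theorem maskCard_edgeMask (H : SimpleGraph (Fin 5)) : maskCard (edgeMask H) = H.edgeSet.ncard := by
  classical
  have h := two_mul_ncard_edgeSet H
  have hb : ∀ e : Fin 10, (edgeMask H).testBit e =
      decide (H.Adj (endpoints e).1 (endpoints e).2) := fun e => by
    rw [Bool.eq_iff_iff, ← edgeIndex_endpoints e, testBit_edgeMask H (endpoints_ne e)]
    simp
  have h0 : (edgeMask H).testBit (0 : Fin 10) = decide (H.Adj 0 1) := hb 0
  have h1 : (edgeMask H).testBit (1 : Fin 10) = decide (H.Adj 0 2) := hb 1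
  have h2 : (edgeMask H).testBit (2 : Fin 10) = decide (H.Adj 1 2) := hb 2
  have h3 : (edgeMask H).testBit (3 : Fin 10) = decide (H.Adj 0 3) := hb 3
  have h4 : (edgeMask H).testBit (4 : Fin 10) = decide (H.Adj 1 3) := hb 4
  have h5 : (edgeMask H).testBit (5 : Fin 10) = decide (H.Adj 2 3) := hb 5
  have h6 : (edgeMask H).testBit (6 : Fin 10) = decide (H.Adj 0 4) := hb 6
  have h7 : (edgeMask H).testBit (7 : Fin 10) = decide (H.Adj 1 4) := hb 7
  have h8 : (edgeMask H).testBit (8 : Fin 10) = decide (H.Adj 2 4) := hb 8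
  have h9 : (edgeMask H).testBit (9 : Fin 10) = decide (H.Adj 3 4) := hb 9
  simp only [Fin.sum_univ_five, SimpleGraph.irrefl, if_false, H.adj_comm 1 0, H.adj_comm 2 0,
    H.adj_comm 3 0, H.adj_comm 4 0, H.adj_comm 2 1, H.adj_comm 3 1, H.adj_comm 4 1,
    H.adj_comm 3 2, H.adj_comm 4 2, H.adj_comm 4 3] at h
  have hr : List.range 10 = [((0 : Fin 10) : ℕ), (1 : Fin 10), (2 : Fin 10), (3 : Fin 10),
    (4 : Fin 10), (5 : Fin 10), (6 : Fin 10), (7 : Fin 10), (8 : Fin 10), (9 : Fin 10)] := by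
    decide
  rw [maskCard, hr]
  simp only [List.countP_cons, List.countP_nil, h0, h1, h2, h3, h4, h5, h6, h7, h8, h9]
  simp only [decide_eq_true_eq]
  omega

/-- The edge-coloured complete graph with the edges in `a` of colour `0`, those of the others that
are in `b` of colour `1`, and the remaining ones of colour `2`. -/
def maskColoring (a b : ℕ) (j k : Fin 5) : Fin 3 :=
  if a.testBit (edgeIndex j k) then 0 else if b.testBit (edgeIndex j k) then 1 else 2

/-- The graphs of the three colours of `maskColoring`. -/
def maskGraph (a b : ℕ) (p : Fin 3) : SimpleGraph (Fin 5) where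
  Adj j k := j ≠ k ∧ maskColoring a b j k = p
  symm := ⟨fun j k h => ⟨h.1.symm, by rw [← h.2, maskColoring, maskColoring, edgeIndex_comm]⟩⟩
  loopless := ⟨fun _ h => h.1 rfl⟩

instance (a b : ℕ) (p : Fin 3) : DecidableRel (maskGraph a b p).Adj := fun j k =>
  inferInstanceAs (Decidable (j ≠ k ∧ maskColoring a b j k = p))

end Masks

/-! ### Equivalence of edge-coloured graphs and an invariant -/

section SameGraph

variable {m n : ℕ}

theorem SameGraph.refl (G : Fin m → SimpleGraph (Fin n)) : SameGraph G G :=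
  ⟨1, 1, fun _ _ _ => Iff.rfl⟩

theorem SameGraph.symm {G H : Fin m → SimpleGraph (Fin n)} (h : SameGraph G H) :
    SameGraph H G := by
  obtain ⟨σ, τ, h⟩ := h
  refine ⟨σ.symm, τ.symm, fun p j k => ?_⟩
  rw [← h]
  simp

theorem SameGraph.trans {G H I : Fin m → SimpleGraph (Fin n)} (h : SameGraph G H)
    (h' : SameGraph H I) : SameGraph G I := by
  obtain ⟨σ, τ, h⟩ := h
  obtain ⟨σ', τ', h'⟩ := h'
  exact ⟨σ.trans σ', τ.trans τ', fun p j k => by simp [h', h]⟩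

theorem sameGraph_comap (G : Fin m → SimpleGraph (Fin n)) (σ : Equiv.Perm (Fin n)) :
    SameGraph (fun p => (G p).comap σ) G :=
  ⟨σ, 1, fun _ _ _ => Iff.rfl⟩

theorem sameGraph_permute (G : Fin m → SimpleGraph (Fin n)) (τ : Equiv.Perm (Fin m)) :
    SameGraph (fun p => G (τ p)) G :=
  ⟨1, τ, fun _ _ _ => Iff.rfl⟩

/-- An invariant of edge-coloured graphs. -/
def signature (G : Fin m → SimpleGraph (Fin n)) [∀ p, DecidableRel (G p).Adj] : ℕ :=
  ∑ p, ∑ j, ((∑ k, if (G p).Adj j k then 1 else 0) +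
    ∑ k, if (G p).Adj j k then ∑ q, if q = p then 0 else
      (∑ l, if (G q).Adj k l then 1 else 0) ^ 2 else 0) ^ 3

theorem SameGraph.signature_eq {G H : Fin m → SimpleGraph (Fin n)} [∀ p, DecidableRel (G p).Adj]
    [∀ p, DecidableRel (H p).Adj] (h : SameGraph G H) : signature G = signature H := by
  obtain ⟨σ, τ, h⟩ := h
  symm
  rw [signature, signature, ← Equiv.sum_comp τ]
  refine Finset.sum_congr rfl fun p _ => ?_
  rw [← Equiv.sum_comp σ]
  refine Finset.sum_congr rfl fun j _ => ?_
  rw [← Equiv.sum_comp σ, ← Equiv.sum_comp σ (fun k => ite ((H (τ p)).Adj (σ j) k) _ _)]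
  simp only [h]
  congr 2
  refine Finset.sum_congr rfl fun k _ => ?_
  congr 1
  rw [← Equiv.sum_comp τ]
  refine Finset.sum_congr rfl fun q _ => ?_
  rw [← Equiv.sum_comp σ]
  simp only [h, τ.apply_eq_iff_eq]

end SameGraph

/-! ### The 27 classes -/

section Classification

/-- The complete graph on five vertices with four edges of colour `0` and three edges of each of the
colours `1` and `2`. -/
structure IsFourThreeThree (G : Fin 3 → SimpleGraph (Fin 5)) : Prop where
  existsUnique_adj : ∀ j k, j ≠ k → ∃! p, (G p).Adj j k
  ncard_edgeSet : ∀ p, (G p).edgeSet.ncard = ![4, 3, 3] p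

theorem ncard_edgeSet_comap {n : ℕ} (H : SimpleGraph (Fin n)) (σ : Equiv.Perm (Fin n)) :
    (H.comap σ).edgeSet.ncard = H.edgeSet.ncard := by
  classical
  have h : 2 * (H.comap σ).edgeSet.ncard = 2 * H.edgeSet.ncard := by
    rw [two_mul_ncard_edgeSet, two_mul_ncard_edgeSet]
    symm
    rw [← Equiv.sum_comp σ]
    refine Finset.sum_congr rfl fun j _ => ?_
    rw [← Equiv.sum_comp σ]
    simp
  omega

variable {G : Fin 3 → SimpleGraph (Fin 5)}

theorem IsFourThreeThree.comap (hG : IsFourThreeThree G) (σ : Equiv.Perm (Fin 5)) :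
    IsFourThreeThree fun p => (G p).comap σ where
  existsUnique_adj j k hjk := hG.existsUnique_adj _ _ (σ.injective.ne hjk)
  ncard_edgeSet p := by rw [ncard_edgeSet_comap, hG.ncard_edgeSet]

theorem IsFourThreeThree.swap (hG : IsFourThreeThree G) :
    IsFourThreeThree fun p => G (Equiv.swap 1 2 p) where
  existsUnique_adj j k hjk := by
    obtain ⟨p, hp, h⟩ := hG.existsUnique_adj j k hjk
    refine ⟨Equiv.swap 1 2 p, by simpa using hp, fun q hq => ?_⟩
    rw [← h _ hq, Equiv.swap_apply_self]
  ncard_edgeSet p := by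
    rw [hG.ncard_edgeSet]
    revert p
    decide

theorem IsFourThreeThree.eq_maskGraph (hG : IsFourThreeThree G) :
    G = maskGraph (edgeMask (G 0)) (edgeMask (G 1)) := by
  funext p
  ext j k
  by_cases hjk : j = k
  · subst hjk
    simp
  obtain ⟨q, hq, hu⟩ := hG.existsUnique_adj j k hjk
  have key : ∀ r, (G r).Adj j k ↔ r = q := fun r => ⟨hu r, fun h => h ▸ hq⟩
  simp only [maskGraph, maskColoring, testBit_edgeMask _ hjk, key, ne_eq, hjk, not_false_eq_true,
    true_and]
  clear key hu hq
  revert p q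
  decide

theorem IsFourThreeThree.edgeMask_two (hG : IsFourThreeThree G) :
    edgeMask (G 2) = restMask (edgeMask (G 0)) (edgeMask (G 1)) := by
  rw [restMask, edgeMask]
  congr 1
  funext e
  obtain ⟨q, hq, hu⟩ := hG.existsUnique_adj _ _ (endpoints_ne e)
  have key : ∀ r, (G r).Adj (endpoints e).1 (endpoints e).2 ↔ r = q :=
    fun r => ⟨hu r, fun h => h ▸ hq⟩
  rw [← edgeIndex_endpoints e, Bool.eq_iff_iff]
  simp only [decide_eq_true_eq, Bool.and_eq_true, Bool.not_eq_true', ← Bool.not_eq_true,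
    testBit_edgeMask _ (endpoints_ne e), key]
  clear key hu hq
  revert q
  decide

theorem IsFourThreeThree.land_eq_zero (hG : IsFourThreeThree G) :
    edgeMask (G 0) &&& edgeMask (G 1) = 0 := by
  refine Nat.eq_of_testBit_eq fun i => ?_
  rw [Nat.testBit_and, Nat.zero_testBit]
  by_cases hi : i < 10
  · have he := edgeIndex_endpoints ⟨i, hi⟩
    obtain ⟨q, hq, hu⟩ := hG.existsUnique_adj _ _ (endpoints_ne ⟨i, hi⟩)
    rw [Bool.and_eq_false_iff]
    by_contra! h
    simp only [ne_eq, Bool.not_eq_false] at h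
    rw [show i = edgeIndex _ _ from he.symm, testBit_edgeMask _ (endpoints_ne _),
      testBit_edgeMask _ (endpoints_ne _)] at h
    exact absurd ((hu 0 h.1).trans (hu 1 h.2).symm) (by decide)
  · rw [Nat.testBit_lt_two_pow, Bool.false_and]
    exact (edgeMask_lt _).trans_le (Nat.pow_le_pow_right two_pos (not_lt.1 hi) : 2 ^ 10 ≤ 2 ^ i)

/-- The masks of the colours `0` and `1` of the 27 graphs. -/
def orbitMasks : Fin 27 → ℕ × ℕ :=
  ![(15, 112), (15, 176), (15, 208), (15, 224), (15, 400), (15, 448), (30, 97), (30, 193),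
    (30, 224), (30, 321), (75, 52), (75, 164), (77, 50), (77, 146), (77, 162), (77, 176),
    (77, 290), (77, 304), (86, 41), (86, 137), (86, 161), (424, 82), (86, 289), (86, 296),
    (116, 11), (116, 131), (801, 138)]

/-- The 27 graphs. -/
def orbitGraph (i : Fin 27) (p : Fin 3) : SimpleGraph (Fin 5) :=
  maskGraph (orbitMasks i).1 (orbitMasks i).2 p

instance (i : Fin 27) (p : Fin 3) : DecidableRel (orbitGraph i p).Adj :=
  inferInstanceAs (DecidableRel (maskGraph _ _ p).Adj)

/-- The masks with four edges that no transposition of two vertices makes smaller. -/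
def minimalMasks : List ℕ := [15, 30, 75, 77, 85, 86, 116, 225]

/-- Relabellings of the 27 graphs that give, up to an interchange of the last two colours, all
graphs that no transposition of two vertices makes smaller. -/
def minimalRelabellings : List (Fin 27 × (Fin 5 → Fin 5)) :=
  [(0, ![0, 1, 2, 3, 4]), (1, ![0, 1, 2, 3, 4]), (2, ![0, 1, 2, 3, 4]), (3, ![0, 1, 2, 3, 4]),
   (4, ![0, 1, 2, 3, 4]), (5, ![0, 1, 2, 3, 4]), (6, ![0, 1, 2, 3, 4]), (6, ![2, 3, 0, 1, 4]),
   (6, ![2, 3, 1, 0, 4]), (7, ![0, 1, 2, 3, 4]), (8, ![0, 1, 2, 3, 4]), (9, ![0, 1, 2, 3, 4]),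
   (9, ![1, 0, 3, 2, 4]), (10, ![0, 1, 2, 3, 4]), (10, ![0, 4, 1, 2, 3]), (11, ![0, 1, 2, 3, 4]),
   (12, ![0, 1, 2, 3, 4]), (12, ![1, 0, 3, 4, 2]), (12, ![1, 0, 4, 3, 2]), (13, ![0, 1, 2, 3, 4]),
   (13, ![1, 0, 3, 4, 2]), (14, ![0, 1, 2, 3, 4]), (14, ![1, 0, 3, 4, 2]), (14, ![1, 0, 4, 3, 2]),
   (15, ![0, 1, 2, 3, 4]), (15, ![1, 0, 3, 4, 2]), (15, ![1, 0, 4, 3, 2]), (16, ![0, 1, 2, 3, 4]),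
   (16, ![1, 0, 3, 4, 2]), (17, ![0, 1, 2, 3, 4]), (17, ![1, 0, 4, 3, 2]), (18, ![0, 1, 2, 3, 4]),
   (18, ![1, 0, 2, 4, 3]), (19, ![0, 1, 2, 3, 4]), (20, ![0, 1, 2, 3, 4]), (20, ![1, 0, 2, 4, 3]),
   (21, ![3, 4, 2, 1, 0]), (21, ![4, 3, 2, 0, 1]), (22, ![0, 1, 2, 3, 4]), (23, ![0, 1, 2, 3, 4]),
   (23, ![1, 0, 2, 4, 3]), (24, ![0, 1, 2, 3, 4]), (24, ![1, 2, 0, 4, 3]), (25, ![0, 1, 2, 3, 4]),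
   (25, ![1, 2, 0, 4, 3]), (26, ![0, 2, 3, 4, 1]), (26, ![0, 4, 2, 3, 1]), (26, ![2, 3, 0, 1, 4]),
   (26, ![4, 2, 0, 1, 3])]

/-- Local minima suffice for a descent, and testing transpositions is cheaper than finding canonical
forms under all 120 relabellings. -/
theorem mem_minimalMasks_or_exists_lt : ∀ a < 1024, maskCard a = 4 →
    a ∈ minimalMasks ∨ ∃ i j, relabelMask (Equiv.swap i j) a < a := by
  decide +kernel

theorem exists_lt_or_exists_relabelling : ∀ a ∈ minimalMasks, ∀ b < 1024, maskCard b = 3 →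
    a &&& b = 0 → restMask a b < b ∨
      (∃ i j, relabelMask (Equiv.swap i j) a = a ∧ relabelMask (Equiv.swap i j) b < b) ∨
      ∃ r ∈ minimalRelabellings, Function.Injective r.2 ∧
        relabelMask r.2 (orbitMasks r.1).1 = a ∧
        (relabelMask r.2 (orbitMasks r.1).2 = b ∨
          relabelMask r.2 (orbitMasks r.1).2 = restMask a b) := by
  decide +kernel

theorem isFourThreeThree_orbitGraph (i : Fin 27) : IsFourThreeThree (orbitGraph i) where
  existsUnique_adj j k hjk :=
    ⟨maskColoring (orbitMasks i).1 (orbitMasks i).2 j k, ⟨hjk, rfl⟩, fun _ h => h.2.symm⟩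
  ncard_edgeSet p := by
    have h := two_mul_ncard_edgeSet (orbitGraph i p)
    have h' : ∀ i p, (∑ j, ∑ k, if (orbitGraph i p).Adj j k then 1 else 0) = 2 * ![4, 3, 3] p := by
      decide +kernel
    rw [h'] at h
    omega

theorem edgeMask_eq_iff {H : SimpleGraph (Fin 5)} {a : ℕ} (ha : a < 1024) :
    edgeMask H = a ↔ ∀ e : Fin 10, H.Adj (endpoints e).1 (endpoints e).2 ↔ a.testBit e = true := by
  have key : ∀ e : Fin 10, (edgeMask H).testBit e = true ↔
      H.Adj (endpoints e).1 (endpoints e).2 := fun e => by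
    rw [← edgeIndex_endpoints e, testBit_edgeMask _ (endpoints_ne e)]
  refine ⟨fun h e => by rw [← key, h], fun h => Nat.eq_of_testBit_eq fun i => ?_⟩
  by_cases hi : i < 10
  · rw [Bool.eq_iff_iff, ← h ⟨i, hi⟩, ← key]
  · have h2 : 1024 ≤ 2 ^ i := (Nat.pow_le_pow_right two_pos (not_lt.1 hi) : 2 ^ 10 ≤ 2 ^ i)
    rw [Nat.testBit_lt_two_pow ((edgeMask_lt _).trans_le h2),
      Nat.testBit_lt_two_pow (ha.trans_le h2)]

theorem edgeMask_orbitGraph (i : Fin 27) :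
    edgeMask (orbitGraph i 0) = (orbitMasks i).1 ∧
      edgeMask (orbitGraph i 1) = (orbitMasks i).2 := by
  have h : ∀ i, (orbitMasks i).1 < 1024 ∧ (orbitMasks i).2 < 1024 := by decide
  rw [edgeMask_eq_iff (h i).1, edgeMask_eq_iff (h i).2]
  revert i
  decide +kernel

theorem IsFourThreeThree.exists_sameGraph (hG : IsFourThreeThree G) :
    ∃ i, SameGraph G (orbitGraph i) := by
  -- Masks are below 1024, so this orders the pairs lexicographically.
  induction h : edgeMask (G 0) * 1024 + edgeMask (G 1) using Nat.strong_induction_on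
    generalizing G with
  | _ N ih =>
    subst h
    have hb := edgeMask_lt (G 1)
    have hrelabel : ∀ i j : Fin 5, relabelMask (Equiv.swap i j) (edgeMask (G 0)) * 1024 +
        relabelMask (Equiv.swap i j) (edgeMask (G 1)) <
          edgeMask (G 0) * 1024 + edgeMask (G 1) → ∃ i, SameGraph G (orbitGraph i) := by
      intro i j hlt
      rw [← edgeMask_comap _ (Equiv.injective _), ← edgeMask_comap _ (Equiv.injective _)] at hlt
      obtain ⟨l, hl⟩ := ih _ hlt (hG.comap (Equiv.swap i j)) rfl
      exact ⟨l, (sameGraph_comap G _).symm.trans hl⟩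
    rcases mem_minimalMasks_or_exists_lt _ (edgeMask_lt (G 0))
      (by rw [maskCard_edgeMask, hG.ncard_edgeSet]; rfl) with ha | ⟨i, j, hij⟩
    swap
    · refine hrelabel i j ?_
      rw [← edgeMask_comap (G 1) (Equiv.injective _)]
      have := edgeMask_lt ((G 1).comap (Equiv.swap i j))
      omega
    rcases exists_lt_or_exists_relabelling _ ha _ hb
      (by rw [maskCard_edgeMask, hG.ncard_edgeSet]; rfl) hG.land_eq_zero with
      hlt | ⟨i, j, hi, hj⟩ | ⟨⟨i, s⟩, -, hs, h0, h1⟩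
    · rw [← hG.edgeMask_two] at hlt
      obtain ⟨l, hl⟩ := ih _ (add_lt_add_right hlt _) hG.swap rfl
      exact ⟨l, (sameGraph_permute G _).symm.trans hl⟩
    · exact hrelabel i j (by rw [hi]; omega)
    · refine ⟨i, ?_⟩
      let σ : Equiv.Perm (Fin 5) := Equiv.ofBijective s (Finite.injective_iff_bijective.1 hs)
      have hO := (isFourThreeThree_orbitGraph i).comap σ
      have hO0 : edgeMask ((orbitGraph i 0).comap σ) = edgeMask (G 0) := by
        rw [edgeMask_comap _ σ.injective, (edgeMask_orbitGraph i).1]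
        exact h0
      have hO1 : edgeMask ((orbitGraph i 1).comap σ) = relabelMask s (orbitMasks i).2 := by
        rw [edgeMask_comap _ σ.injective, (edgeMask_orbitGraph i).2]
        rfl
      refine SameGraph.trans ?_ (sameGraph_comap (orbitGraph i) σ)
      rcases h1 with h1 | h1
      · rw [hO.eq_maskGraph, hG.eq_maskGraph]
        simp only [hO0, hO1, h1]
        exact SameGraph.refl _
      -- Here the relabelled graph matches `G` with its last two colours exchanged.
      · refine (sameGraph_permute G (Equiv.swap 1 2)).symm.trans ?_
        rw [hO.eq_maskGraph, hG.swap.eq_maskGraph]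
        simp only [hO0, hO1, h1, ← hG.edgeMask_two]
        exact SameGraph.refl _

/-- The weights in `signature` matter only in that the 27 values differ, which gives uniqueness of
the class. -/
theorem signature_orbitGraph_injective :
    Function.Injective fun i => signature (orbitGraph i) := by
  have h : (fun i => signature (orbitGraph i)) = ![11624, 17572, 11770, 8976, 9812, 25698, 12090,
      10000, 5684, 7872, 28460, 16852, 16250, 9408, 10024, 10758, 18694, 8440, 11658, 8064, 6044,
      6156, 6854, 7750, 14360, 6880, 5508] := by
    funext i
    revert i
    decide +kernel
  rw [h]
  decide +kernel

theorem IsFourThreeThree.existsUnique_sameGraph (hG : IsFourThreeThree G) :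
    ∃! i, SameGraph G (orbitGraph i) := by
  obtain ⟨i, hi⟩ := hG.exists_sameGraph
  exact ⟨i, hi, fun j hj => signature_orbitGraph_injective (hj.symm.trans hi).signature_eq⟩

/-- The masks listed for the two exceptional graphs encode their prescribed labellings, so equality
is literal. -/
theorem orbitGraph_eq_graphPath : orbitGraph 21 = graphPath := by
  funext p
  ext j k
  fin_cases p <;> revert j k <;> simp [graphPath] <;> decide +kernel

theorem orbitGraph_eq_graphTriangle : orbitGraph 26 = graphTriangle := by
  funext p
  ext j k
  fin_cases p <;> revert j k <;> simp [graphTriangle] <;> decide +kernel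

end Classification

/-! ### Realizing arbitrary orthogonality graphs -/

section Realization

variable {n : ℕ}

/-- A vector indexed by pairs of vertices of `H`, with the entry `1` at the pairs of vertices that
contain `j` and are not adjacent. Such vectors are orthogonal exactly for adjacent vertices. -/
noncomputable def nonadjacencyVector (H : SimpleGraph (Fin n)) (j : Fin n) :
    EuclideanSpace ℂ (Fin (n * n)) :=
  open Classical in WithLp.toLp 2 fun x =>
    if (j = (finProdFinEquiv.symm x).1 ∨ j = (finProdFinEquiv.symm x).2) ∧
      ¬ H.Adj (finProdFinEquiv.symm x).1 (finProdFinEquiv.symm x).2 then 1 else 0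

/-- The inner product counts the nonadjacent ordered pairs containing both `j` and `k`; for `j ≠ k`
only `(j, k)` and `(k, j)` qualify. For `j = k` the loop `(j, j)` always counts. -/
theorem inner_nonadjacencyVector_eq_zero_iff (H : SimpleGraph (Fin n)) (j k : Fin n) :
    inner ℂ (nonadjacencyVector H j) (nonadjacencyVector H k) = 0 ↔ H.Adj j k := by
  classical
  have h : inner ℂ (nonadjacencyVector H j) (nonadjacencyVector H k) =
      ((∑ x : Fin (n * n),
        if ((j = (finProdFinEquiv.symm x).1 ∨ j = (finProdFinEquiv.symm x).2) ∧
            (k = (finProdFinEquiv.symm x).1 ∨ k = (finProdFinEquiv.symm x).2)) ∧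
          ¬ H.Adj (finProdFinEquiv.symm x).1 (finProdFinEquiv.symm x).2 then 1 else 0 : ℕ) : ℂ) := by
    rw [PiLp.inner_apply, Nat.cast_sum]
    refine Finset.sum_congr rfl fun x _ => ?_
    simp only [nonadjacencyVector, RCLike.inner_apply]
    generalize finProdFinEquiv.symm x = y
    by_cases h1 : j = y.1 ∨ j = y.2 <;> by_cases h2 : k = y.1 ∨ k = y.2 <;>
      by_cases h3 : H.Adj y.1 y.2 <;> simp [h1, h2, h3]
  rw [h, Nat.cast_eq_zero, Finset.sum_eq_zero_iff]
  constructor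
  · intro h0
    have := h0 (finProdFinEquiv (j, k)) (Finset.mem_univ _)
    simpa using this
  · intro hjk x _
    rw [if_neg]
    rintro ⟨⟨h1, h2⟩, h3⟩
    have hne := hjk.ne
    rcases h1 with h1 | h1 <;> rcases h2 with h2 | h2
    · exact hne (h1.trans h2.symm)
    · exact h3 (h1 ▸ h2 ▸ hjk)
    · exact h3 (h1 ▸ h2 ▸ hjk.symm)
    · exact hne (h1.trans h2.symm)

theorem exists_inner_eq_zero_iff_adj (H : SimpleGraph (Fin n)) :
    ∃ v : Fin n → EuclideanSpace ℂ (Fin (n * n)), (∀ j, ‖v j‖ = 1) ∧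
      ∀ j k, inner ℂ (v j) (v k) = 0 ↔ H.Adj j k := by
  have hne : ∀ j, nonadjacencyVector H j ≠ 0 := fun j h => by
    have := inner_nonadjacencyVector_eq_zero_iff H j j
    simp [h] at this
  refine ⟨fun j => ((‖nonadjacencyVector H j‖⁻¹ : ℝ) : ℂ) • nonadjacencyVector H j,
    fun j => ?_, fun j k => ?_⟩
  · rw [norm_smul, Complex.norm_real, norm_inv, norm_norm,
      inv_mul_cancel₀ (norm_ne_zero_iff.2 (hne j))]
  · rw [inner_smul_left, inner_smul_right, ← inner_nonadjacencyVector_eq_zero_iff]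
    simp [hne]

variable {m : ℕ} {d : Fin m → ℕ} {v : Fin n → ∀ p, EuclideanSpace ℂ (Fin (d p))}

theorem IsSinglyOrthogonal.existsUnique_adj (hv : IsSinglyOrthogonal v) {j k : Fin n}
    (hjk : j ≠ k) : ∃! p, (orthogonalityGraph v p).Adj j k := by
  simpa [orthogonalityGraph, hjk] using hv.existsUnique_orthogonal j k hjk

theorem isSinglyOrthogonal_of_existsUnique_adj (hv : ∀ j p, ‖v j p‖ = 1)
    (h : ∀ j k, j ≠ k → ∃! p, (orthogonalityGraph v p).Adj j k) : IsSinglyOrthogonal v :=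
  ⟨hv, fun j k hjk => by simpa [orthogonalityGraph, hjk] using h j k hjk⟩

theorem exists_orthogonalityGraph_eq (G : Fin m → SimpleGraph (Fin n)) :
    ∃ v : Fin n → Fin m → EuclideanSpace ℂ (Fin (n * n)), (∀ j p, ‖v j p‖ = 1) ∧
      orthogonalityGraph (d := fun _ => n * n) v = G := by
  choose v hv h using fun p => exists_inner_eq_zero_iff_adj (G p)
  refine ⟨fun j p => v p j, fun j p => hv p j, ?_⟩
  funext p
  ext j k
  exact ⟨fun hjk => (h p j k).1 hjk.2, fun hjk => ⟨hjk.ne, (h p j k).2 hjk⟩⟩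

end Realization

/-! ### Application to five states -/

section FiveStates

variable {d : Fin 3 → ℕ} {v : Fin 5 → ∀ p, EuclideanSpace ℂ (Fin (d p))}

theorem IsSinglyOrthogonal.isFourThreeThree (hv : IsSinglyOrthogonal v)
    (h : orthogonalityVector v = ![4, 3, 3]) : IsFourThreeThree (orthogonalityGraph v) :=
  ⟨fun _ _ hjk => hv.existsUnique_adj hjk, fun p => congrFun h p⟩

theorem IsFourThreeThree.isSinglyOrthogonal_and {G : Fin 3 → SimpleGraph (Fin 5)}
    (hG : IsFourThreeThree G) (hv : ∀ j p, ‖v j p‖ = 1) (h : orthogonalityGraph v = G) :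
    IsSinglyOrthogonal v ∧ orthogonalityVector v = ![4, 3, 3] ∧ orthogonalityGraph v = G := by
  subst h
  exact ⟨isSinglyOrthogonal_of_existsUnique_adj hv hG.existsUnique_adj,
    funext hG.ncard_edgeSet, rfl⟩

theorem norm_productState_eq_one (hv : ∀ j p, ‖v j p‖ = 1) (j : Fin 5) :
    ‖productState (v j)‖ ^ 2 = 1 := by
  simp [norm_productState_sq, hv]

theorem perfectlyDistinguishable_iff (hv : ∀ j p, ‖v j p‖ = 1) :
    PerfectlyDistinguishable (fun j => productState (v j)) ↔
      ∃ P : Protocol d (Fin 5), P.Identifies v := by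
  simp only [PerfectlyDistinguishable, Protocol.Identifies, norm_productState_eq_one hv]

theorem reducible_orbitMasks : ∀ i, i ≠ 21 → i ≠ 26 →
    reducible (List.finRange 3) (maskColoring (orbitMasks i).1 (orbitMasks i).2) 4
      (List.finRange 5) = true := by
  decide +kernel

theorem perfectlyDistinguishable_of_sameGraph (hv : ∀ j p, ‖v j p‖ = 1) {i : Fin 27}
    (h21 : i ≠ 21) (h26 : i ≠ 26) (h : SameGraph (orthogonalityGraph v) (orbitGraph i)) :
    PerfectlyDistinguishable fun j => productState (v j) := by
  rw [perfectlyDistinguishable_iff hv]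
  obtain ⟨σ, τ, h⟩ := h
  -- The game is played with the colours of `orbitGraph i`; `τ.symm` turns them back into parties.
  refine exists_identifies_of_reducible τ.symm.injective σ 4 (reducible_orbitMasks i h21 h26) v
    (fun j hj => absurd (List.mem_finRange _) hj) fun j k _ _ hjk => ?_
  refine ((h _ j k).1 ⟨σ.injective.ne hjk, ?_⟩).2
  simp

theorem hasMatchings_graphPath : HasMatchings graphPath := by
  -- In this order of the states the three matchings appear cyclically shifted.
  refine ⟨⟨![0, 1, 3, 4], by decide⟩, 1, finRotate 3, fun p j k => ?_⟩
  fin_cases p <;> revert j k <;> simp [graphPath, graphMatchings] <;> decide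

theorem hasMatchings_graphTriangle : HasMatchings graphTriangle := by
  refine ⟨⟨![0, 1, 3, 4], by decide⟩, 1, 1, fun p j k => ?_⟩
  fin_cases p <;> revert j k <;> simp [graphTriangle, graphMatchings] <;> decide

end FiveStates

end LocalDiscrimination

theorem theorem12 :
    ∃ Γ : Fin 27 → Fin 3 → SimpleGraph (Fin 5),
      -- each of the 27 graphs is the orthogonality graph of some set of states
      (∀ i, ∃ (d : Fin 3 → ℕ) (v : Fin 5 → ∀ p, EuclideanSpace ℂ (Fin (d p))),
        LocalDiscrimination.IsSinglyOrthogonal v ∧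
        LocalDiscrimination.orthogonalityVector v = ![4, 3, 3] ∧
        LocalDiscrimination.orthogonalityGraph v = Γ i) ∧
      -- each orthogonality graph is exactly one of the 27
      (∀ (d : Fin 3 → ℕ) (v : Fin 5 → ∀ p, EuclideanSpace ℂ (Fin (d p))),
        LocalDiscrimination.IsSinglyOrthogonal v →
        LocalDiscrimination.orthogonalityVector v = ![4, 3, 3] →
        ∃! i, LocalDiscrimination.SameGraph (LocalDiscrimination.orthogonalityGraph v) (Γ i)) ∧
      -- the two special graphs
      Γ 21 = LocalDiscrimination.graphPath ∧
      Γ 26 = LocalDiscrimination.graphTriangle ∧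
      LocalDiscrimination.HasMatchings (Γ 21) ∧
      LocalDiscrimination.HasMatchings (Γ 26) ∧
      -- in all other graphs, every set of states can be perfectly distinguished
      (∀ i, i ≠ 21 → i ≠ 26 →
        ∀ (d : Fin 3 → ℕ) (v : Fin 5 → ∀ p, EuclideanSpace ℂ (Fin (d p))),
          LocalDiscrimination.IsSinglyOrthogonal v →
          LocalDiscrimination.orthogonalityVector v = ![4, 3, 3] →
          LocalDiscrimination.SameGraph (LocalDiscrimination.orthogonalityGraph v) (Γ i) →
          LocalDiscrimination.PerfectlyDistinguishable
            fun j => LocalDiscrimination.productState (v j)) ∧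
      -- in each of the two special graphs this fails
      (∀ i, i = 21 ∨ i = 26 →
        ∃ (d : Fin 3 → ℕ) (v : Fin 5 → ∀ p, EuclideanSpace ℂ (Fin (d p))),
          LocalDiscrimination.IsSinglyOrthogonal v ∧
          LocalDiscrimination.orthogonalityVector v = ![4, 3, 3] ∧
          LocalDiscrimination.orthogonalityGraph v = Γ i ∧
          ¬ LocalDiscrimination.PerfectlyDistinguishable
            fun j => LocalDiscrimination.productState (v j)) := by
  open LocalDiscrimination in
  refine ⟨orbitGraph, fun i => ?_, fun d v hv h => ?_, orbitGraph_eq_graphPath,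
    orbitGraph_eq_graphTriangle, orbitGraph_eq_graphPath ▸ hasMatchings_graphPath,
    orbitGraph_eq_graphTriangle ▸ hasMatchings_graphTriangle, fun i h21 h26 d v hv _ h =>
      perfectlyDistinguishable_of_sameGraph hv.norm_eq_one h21 h26 h, fun i hi => ?_⟩
  · obtain ⟨v, hv, h⟩ := exists_orthogonalityGraph_eq (orbitGraph i)
    exact ⟨_, v, (isFourThreeThree_orbitGraph i).isSinglyOrthogonal_and hv h⟩
  · exact (hv.isFourThreeThree h).existsUnique_sameGraph
  · rcases hi with rfl | rfl
    · obtain ⟨h1, h2, h3⟩ := (isFourThreeThree_orbitGraph 21).isSinglyOrthogonal_and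
        norm_pathStates (orthogonalityGraph_pathStates.trans orbitGraph_eq_graphPath.symm)
      exact ⟨_, pathStates, h1, h2, h3, fun h => by
        obtain ⟨P, hP⟩ := (perfectlyDistinguishable_iff norm_pathStates).1 h
        exact not_identifies_pathStates P hP⟩
    · obtain ⟨h1, h2, h3⟩ := (isFourThreeThree_orbitGraph 26).isSinglyOrthogonal_and
        norm_triangleStates
        (orthogonalityGraph_triangleStates.trans orbitGraph_eq_graphTriangle.symm)
      exact ⟨_, triangleStates, h1, h2, h3, fun h => by
        obtain ⟨P, hP⟩ := (perfectlyDistinguishable_iff norm_triangleStates).1 h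
        exact not_identifies_triangleStates P hP⟩
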